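/- Let $(X,\mathcal B)$ be a standard Borel space and let $Aut(X,\mathcal B)$ be the group of its Borel automorphisms. For $S,T\in Aut(X,\mathcal B)$ put $E(S,T)=\{x: Tx\ne Sx\}\cup\{x: T^{-1}x\neq S^{-1}x\}$, and let $\tau$ be the topology on $Aut(X,\mathcal B)$ with the base of sets $$U(T;\mu_1,\dots,\mu_n;\varepsilon)=\{S\in Aut(X,\mathcal B): \mu_i(E(S,T))<\varepsilon,\ i=1,\dots,n\},$$ where $T\in Aut(X,\mathcal B)$, $\mu_1,\dots,\mu_n$ are Borel probability measures on $X$, and $\varepsilon>0$. Let $T\in Aut(X,\mathcal B)$ be aperiodic (no periodic points) and non-smooth (no Borel set meets every $T$-orbit exactly once). A $T$-multitower $\eta$ is an at most countable family of pairwise disjoint $T$-towers $(B_0(j),TB_0(j),\dots,T^{n_j}B_0(j))$, $j\in J$, each consisting of pairwise disjoint sets (the atoms) over an uncountable Borel set $B_0(j)$; its support is the union of its atoms, and its rank is $|J|$. A multitower $\eta'$ refines $\eta$ if every atom of $\eta$ is a union of atoms of $\eta'$. $T$ has rank at most $r$ if there is a sequence $(\eta_n)$ of $T$-multitowers of rank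 at most $r$ such that $\eta_{n+1}$ refines $\eta_n$ for all $n$, the supports of the $\eta_n$ have union $X$, and the atoms of all the $\eta_n$ together generate $\mathcal B$. Let $\mathcal R(1)$ be the set of those $T$ that have rank at most $1$ but not rank at most $0$. Given integers $\lambda_t\ge 2$, $t\geq 0$, put $p_{-1}=1$, $p_t=\lambda_0\cdots\lambda_t$, and let $Z_\lambda=\{\sum_{i\ge 0}x_ip_{i-1}: 0\le x_i<\lambda_i\}$ be the compact group of $(p_t)$-adic numbers, with addition with carry. Let $\mathcal Od\subset Aut(X,\mathcal B)$ be the set of odometers, i.e. of the automorphisms that are Borel isomorphic to $z\mapsto z+1$ on $Z_\lambda$ for some such sequence $(\lambda_t)$. Then $\overline{\mathcal R(1)}^{\,\tau}=\overline{\mathcal Od}^{\,\tau}$. -/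

import Mathlib

open scoped Topology

namespace BorelAut

/-! ### The uniform topology on `Aut(X, B)` -/

/-- The set `E(S,T) = {x | T x ≠ S x} ∪ {x | T⁻¹ x ≠ S⁻¹ x}`. -/
def diffSet {X : Type*} [MeasurableSpace X] (S T : X ≃ᵐ X) : Set X :=
  {x | T x ≠ S x} ∪ {x | T.symm x ≠ S.symm x}

/-- The basic neighborhood `U(T; μ₁, …, μₙ; ε)`. -/
def basicNhd {X : Type*} [MeasurableSpace X] (T : X ≃ᵐ X) {n : ℕ}
    (μ : Fin n → MeasureTheory.ProbabilityMeasure X) (ε : ℝ) : Set (X ≃ᵐ X) :=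
  {S | ∀ i, ((μ i (diffSet S T) : NNReal) : ℝ) < ε}

/-- The uniform topology `τ` on the group of Borel automorphisms of `X`, generated by the sets
`U(T; μ₁, …, μₙ; ε)`. -/
abbrev tau (X : Type*) [MeasurableSpace X] : TopologicalSpace (X ≃ᵐ X) :=
  TopologicalSpace.generateFrom
    {U | ∃ (T : X ≃ᵐ X) (n : ℕ) (μ : Fin n → MeasureTheory.ProbabilityMeasure X) (ε : ℝ),
      0 < ε ∧ U = basicNhd T μ ε}

/-! ### Aperiodic and smooth automorphisms -/

/-- No point is periodic. -/
def IsAperiodic {X : Type*} [MeasurableSpace X] (T : X ≃ᵐ X) : Prop :=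
  ∀ x, x ∉ Function.periodicPts (T : X → X)

/-- `T` is smooth if some Borel set meets every `T`-orbit exactly once. -/
def IsSmooth {X : Type*} [MeasurableSpace X] (T : X ≃ᵐ X) : Prop :=
  ∃ A : Set X, MeasurableSet A ∧ ∀ x, ∃! y, y ∈ A ∧ Equiv.Perm.SameCycle T.toEquiv x y

/-! ### Multitowers and rank -/

/-- A `T`-multitower: a finite or countable disjoint collection of towers
`(B₀(j), T B₀(j), …, T ^ (n_j) B₀(j))` over uncountable Borel bases `B₀(j)`. -/
structure Multitower {X : Type*} [MeasurableSpace X] (T : X ≃ᵐ X) where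
  /-- the index set of the towers -/
  J : Type
  countable_J : Countable J
  /-- the base of each tower -/
  base : J → Set X
  /-- the index of the top level of each tower -/
  top : J → ℕ
  measurable_base : ∀ j, MeasurableSet (base j)
  uncountable_base : ∀ j, ¬ (base j).Countable
  /-- all the levels of all the towers are pairwise disjoint -/
  disjoint_levels : ∀ j i j' i', i ≤ top j → i' ≤ top j' → (j ≠ j' ∨ i ≠ i') →
    Disjoint ((T : X → X)^[i] '' base j) ((T : X → X)^[i'] '' base j')

/-- The atoms of a multitower: the levels of its towers. -/
def Multitower.atoms {X : Type*} [MeasurableSpace X] {T : X ≃ᵐ X} (η : Multitower T) :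
    Set (Set X) :=
  {A | ∃ (j : η.J) (i : ℕ), i ≤ η.top j ∧ A = (T : X → X)^[i] '' η.base j}

/-- The support of a multitower: the union of its atoms. -/
def Multitower.support {X : Type*} [MeasurableSpace X] {T : X ≃ᵐ X} (η : Multitower T) : Set X :=
  ⋃₀ η.atoms

/-- The rank of a multitower: the number of its towers. -/
noncomputable def Multitower.rank {X : Type*} [MeasurableSpace X] {T : X ≃ᵐ X}
    (η : Multitower T) : ℕ∞ :=
  ENat.card η.J

/-- `η'` refines `η`: every atom of `η` is a union of atoms of `η'`. The support of `η'` thus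
contains that of `η` and may be larger (there may be spacers), and the atoms of `η'` that meet
the support of `η` are contained in atoms of `η`. -/
def Multitower.Refines {X : Type*} [MeasurableSpace X] {T : X ≃ᵐ X} (η' η : Multitower T) : Prop :=
  ∀ A ∈ η.atoms, ∃ C ⊆ η'.atoms, A = ⋃₀ C

/-- `T` (aperiodic and not smooth) has rank at most `r`: there is a refining sequence of
multitowers of rank at most `r` whose supports exhaust `X` and whose atoms generate the Borel
σ-algebra. -/
def HasRankAtMost {X : Type*} [m : MeasurableSpace X] (T : X ≃ᵐ X) (r : ℕ) : Prop :=
  IsAperiodic T ∧ ¬ IsSmooth T ∧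
    ∃ η : ℕ → Multitower T,
      (∀ n, (η n).rank ≤ r) ∧
      (∀ n, (η (n + 1)).Refines (η n)) ∧
      (⋃ n, (η n).support) = Set.univ ∧
      MeasurableSpace.generateFrom (⋃ n, (η n).atoms) = m

/-- The set `R(r)` of automorphisms of rank `r`: rank at most `r` and not less. -/
def rankSet (X : Type*) [MeasurableSpace X] (r : ℕ) : Set (X ≃ᵐ X) :=
  {T | HasRankAtMost T r ∧ ∀ s < r, ¬ HasRankAtMost T s}

/-! ### Odometers -/

/-- The set of formal series `∑ xᵢ pᵢ₋₁` with digits `xᵢ ∈ {0, …, lᵢ - 1}`, where `p₋₁ = 1` and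
`pᵢ = l₀ l₁ ⋯ lᵢ`. It carries the product σ-algebra, which is the Borel σ-algebra of the
product topology. -/
abbrev AdicSeries (l : ℕ → ℕ) : Type := ∀ i, Fin (l i)

/-- The carry into digit `i` when `x` and `y` are added. -/
def carry {l : ℕ → ℕ} (x y : AdicSeries l) : ℕ → ℕ
  | 0 => 0
  | i + 1 => ((x i : ℕ) + (y i : ℕ) + carry x y i) / l i

/-- Addition of formal series, with carry to the right. -/
def adicAdd {l : ℕ → ℕ} (x y : AdicSeries l) : AdicSeries l := fun i =>
  ⟨((x i : ℕ) + (y i : ℕ) + carry x y i) % l i,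
    Nat.mod_lt _ (lt_of_le_of_lt (Nat.zero_le _) (x i).isLt)⟩

/-- The element `1 = 1 p₋₁ + 0 p₀ + 0 p₁ + ⋯`. -/
def adicOne {l : ℕ → ℕ} (hl : ∀ i, 2 ≤ l i) : AdicSeries l := fun i =>
  ⟨if i = 0 then 1 else 0, by have := hl i; split <;> omega⟩

/-- The set `Od` of odometers on `X`: the automorphisms that are Borel isomorphic to
`x ↦ x + 1` on the group of `(pₜ)`-adic numbers, for some sequence of integers `lₜ ≥ 2`. -/
def odometers (X : Type*) [MeasurableSpace X] : Set (X ≃ᵐ X) :=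
  {S | ∃ (l : ℕ → ℕ) (hl : ∀ i, 2 ≤ l i) (e : X ≃ᵐ AdicSeries l),
    ∀ x, e (S x) = adicAdd (e x) (adicOne hl)}

end BorelAut

/-! The two closures agree once odometers have rank one and every rank-one `T` is a `τ`-limit of
odometers. For the first (`odometers_subset_rankSet_one`), the cylinders of length `n` form a single
tower filling the space, and the product of the uniform measures is invariant, which by Poincaré
recurrence excludes a Borel transversal.

For the second, `exists_measure_nhd_subset` leaves a single finite measure `ν` to control. Rank one
provides towers over `B n` with top level `m n` whose supports exhaust `X` and whose levels
eventually separate points. A map that follows `T` up such a tower can differ from `T` only off the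
tower and on its top, and their inverses only off the tower and on its base. The complement of the
tower becomes `ν`-small. Two points that share a top infinitely often coincide; so either no point
is in infinitely many tops, or some `x` is, and along those `n` every other point eventually leaves
the top, and every point but `T x` the base. Hence top and base become small up to one pair `x`, `T
x` (`exists_measure_lt`). This pair may carry an atom of `ν`, so the odometer must also send `x` to
`T x`.

It remains to extend a finite tower to an odometer on all of `X` (`exists_odometer_of_tower`). The
complement of the tower may be countable, so the columns over an uncountable part `A` of the base,
of small measure, are given up. What lies outside is then uncountable and can be cut into further
columns of the same height. The set of columns is an uncountable standard Borel space, hence a copy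
of `Fin 2 × (ℕ → Fin 2)`, and climbing a column becomes adding `1` in the digits `2 * (m + 1), 2, 2,
…`. -/

namespace BorelAut

open MeasureTheory Finset

/-! ### Partial sums of formal series -/

section PartialSums

variable {l : ℕ → ℕ}

/-- The product `l 0 * ⋯ * l (n - 1)`. -/
def place (l : ℕ → ℕ) (n : ℕ) : ℕ := ∏ i ∈ range n, l i

/-- The sum of the first `n` terms of the formal series `x`. -/
def partialSum (x : AdicSeries l) (n : ℕ) : ℕ := ∑ i ∈ range n, (x i : ℕ) * place l i

lemma place_succ (n : ℕ) : place l (n + 1) = place l n * l n := prod_range_succ _ _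

lemma partialSum_succ (x : AdicSeries l) (n : ℕ) :
    partialSum x (n + 1) = partialSum x n + x n * place l n := sum_range_succ _ _

lemma partialSum_lt (x : AdicSeries l) (n : ℕ) : partialSum x n < place l n := by
  induction n with
  | zero => simp [partialSum, place]
  | succ n ih =>
    rw [partialSum_succ, place_succ]
    have h : (x n : ℕ) + 1 ≤ l n := (x n).isLt
    have := Nat.mul_le_mul_left (place l n) h
    nlinarith

lemma place_pos (x : AdicSeries l) (n : ℕ) : 0 < place l n :=
  (Nat.zero_le _).trans_lt (partialSum_lt x n)

lemma two_pow_le_place (hl : ∀ i, 2 ≤ l i) (n : ℕ) : 2 ^ n ≤ place l n := by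
  induction n with
  | zero => simp [place]
  | succ n ih => rw [place_succ, pow_succ]; exact Nat.mul_le_mul ih (hl n)

lemma partialSum_eq_iff {x y : AdicSeries l} {n : ℕ} :
    partialSum x n = partialSum y n ↔ ∀ i < n, x i = y i := by
  induction n with
  | zero => simp [partialSum]
  | succ n ih =>
    constructor
    · intro h
      have hmod := congrArg (· % place l n) h
      have hdiv := congrArg (· / place l n) h
      simp only [partialSum_succ, Nat.add_mul_mod_self_right, Nat.mod_eq_of_lt (partialSum_lt _ _),
        Nat.add_mul_div_right _ _ (place_pos x n), Nat.div_eq_of_lt (partialSum_lt _ _),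
        zero_add] at hmod hdiv
      intro i hi
      rcases Nat.lt_succ_iff_lt_or_eq.1 hi with hi | rfl
      · exact ih.1 hmod i hi
      · exact Fin.ext hdiv
    · intro h
      rw [partialSum_succ, partialSum_succ, ih.2 fun i hi => h i (by omega), h n (by omega)]

lemma partialSum_succ_mod (x : AdicSeries l) (n : ℕ) :
    partialSum x (n + 1) % place l n = partialSum x n := by
  rw [partialSum_succ, Nat.add_mul_mod_self_right, Nat.mod_eq_of_lt (partialSum_lt _ _)]

lemma partialSum_succ_div (x : AdicSeries l) (n : ℕ) :
    partialSum x (n + 1) / place l n = x n := by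
  rw [partialSum_succ, Nat.add_mul_div_right _ _ (place_pos x n),
    Nat.div_eq_of_lt (partialSum_lt _ _), zero_add]

/-- Residues modulo all `place l n` determine a series, so identities between series reduce to
congruences and carries need not be followed. -/
lemma eq_of_partialSum_modEq {x y : AdicSeries l}
    (h : ∀ n, partialSum x n ≡ partialSum y n [MOD place l n]) : x = y := by
  funext i
  exact partialSum_eq_iff.1 ((h (i + 1)).eq_of_lt_of_lt (partialSum_lt _ _) (partialSum_lt _ _)) i
    (Nat.lt_succ_self i)

lemma partialSum_adicAdd (x y : AdicSeries l) (n : ℕ) :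
    partialSum (adicAdd x y) n + carry x y n * place l n = partialSum x n + partialSum y n := by
  induction n with
  | zero => simp [partialSum, carry]
  | succ n ih =>
    simp only [partialSum_succ, place_succ, adicAdd, carry] at ih ⊢
    have := Nat.mod_add_div ((x n : ℕ) + y n + carry x y n) (l n)
    linear_combination ih + place l n * this

lemma partialSum_adicAdd_modEq (x y : AdicSeries l) (n : ℕ) :
    partialSum (adicAdd x y) n ≡ partialSum x n + partialSum y n [MOD place l n] := by
  rw [← partialSum_adicAdd]
  simp [Nat.ModEq]

/-- Equality fails at `n = 0`, where the empty sum is `0`; modulo `place l 0 = 1` this is harmless.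
-/
lemma partialSum_adicOne_modEq (hl : ∀ i, 2 ≤ l i) (n : ℕ) :
    partialSum (adicOne hl) n ≡ 1 [MOD place l n] := by
  cases n with
  | zero => simp [place, Nat.modEq_one]
  | succ n =>
    have : partialSum (adicOne hl) (n + 1) = 1 := by
      simp [partialSum, adicOne, place]
    rw [this]

/-- The series all of whose digits are maximal, which is `-1`. -/
def adicNegOne (hl : ∀ i, 2 ≤ l i) : AdicSeries l := fun i => ⟨l i - 1, by have := hl i; omega⟩

lemma partialSum_adicNegOne (hl : ∀ i, 2 ≤ l i) (n : ℕ) :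
    partialSum (adicNegOne hl) n + 1 = place l n := by
  induction n with
  | zero => simp [partialSum, place]
  | succ n ih =>
    obtain ⟨k, hk⟩ : ∃ k, l n = k + 1 := ⟨l n - 1, by have := hl n; omega⟩
    have hd : ((adicNegOne hl n : Fin (l n)) : ℕ) = k := by simp [adicNegOne, hk]
    rw [partialSum_succ, place_succ, hd, hk]
    linear_combination ih

lemma measurable_carry (y : AdicSeries l) (n : ℕ) :
    Measurable fun x : AdicSeries l => carry x y n := by
  induction n with
  | zero => exact measurable_const
  | succ n ih =>
    exact (Measurable.of_discrete (f := fun p : Fin (l n) × ℕ =>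
      ((p.1 : ℕ) + (y n : ℕ) + p.2) / l n)).comp ((measurable_pi_apply n).prodMk ih)

lemma measurable_adicAdd (y : AdicSeries l) : Measurable fun x : AdicSeries l => adicAdd x y := by
  refine measurable_pi_iff.2 fun n => ?_
  exact (Measurable.of_discrete (f := fun p : Fin (l n) × ℕ =>
    (⟨((p.1 : ℕ) + (y n : ℕ) + p.2) % l n, Nat.mod_lt _ ((Nat.zero_le _).trans_lt (y n).isLt)⟩ :
      Fin (l n)))).comp ((measurable_pi_apply n).prodMk (measurable_carry y n))

/-- Translation by `1`, as an automorphism. -/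
def odometerEquiv (hl : ∀ i, 2 ≤ l i) : AdicSeries l ≃ᵐ AdicSeries l where
  toFun x := adicAdd x (adicOne hl)
  invFun x := adicAdd x (adicNegOne hl)
  left_inv x := eq_of_partialSum_modEq fun n => by
    refine (partialSum_adicAdd_modEq _ _ _).trans
      (((partialSum_adicAdd_modEq _ _ _).add_right _).trans ?_)
    refine (((partialSum_adicOne_modEq hl n).add_left _).add_right _).trans ?_
    rw [add_assoc, add_comm 1, partialSum_adicNegOne]
    simp [Nat.ModEq]
  right_inv x := eq_of_partialSum_modEq fun n => by
    refine (partialSum_adicAdd_modEq _ _ _).trans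
      (((partialSum_adicAdd_modEq _ _ _).add_right _).trans ?_)
    refine ((partialSum_adicOne_modEq hl n).add_left _).trans ?_
    rw [add_assoc, partialSum_adicNegOne]
    simp [Nat.ModEq]
  measurable_toFun := measurable_adicAdd _
  measurable_invFun := measurable_adicAdd _

lemma partialSum_odometerEquiv_modEq (hl : ∀ i, 2 ≤ l i) (x : AdicSeries l) (n : ℕ) :
    partialSum (odometerEquiv hl x) n ≡ partialSum x n + 1 [MOD place l n] :=
  (partialSum_adicAdd_modEq _ _ _).trans ((partialSum_adicOne_modEq hl n).add_left _)

/-- Adding `1` without carry. -/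
lemma odometerEquiv_eq_of_lt (hl : ∀ i, 2 ≤ l i) {x y : AdicSeries l}
    (h0 : (y 0 : ℕ) = x 0 + 1) (h : ∀ i, y (i + 1) = x (i + 1)) : odometerEquiv hl x = y := by
  refine eq_of_partialSum_modEq fun n => (partialSum_odometerEquiv_modEq hl x n).trans ?_
  cases n with
  | zero => simp [place, Nat.modEq_one]
  | succ n =>
    have : partialSum x (n + 1) + 1 = partialSum y (n + 1) := by
      simp only [partialSum, sum_range_succ', h, h0]
      simp [place, add_assoc]
    rw [this]

lemma uncountable_adicSeries (hl : ∀ i, 2 ≤ l i) : Uncountable (AdicSeries l) := by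
  let f : (ℕ → Bool) → AdicSeries l := fun b i => ⟨if b i then 1 else 0, by
    have := hl i; split <;> omega⟩
  have hf : Function.Injective f := by
    intro b c h
    funext i
    have := congrArg Fin.val (congrFun h i)
    simp only [f] at this
    cases hb : b i <;> cases hc : c i <;> simp_all
  have : Uncountable (ℕ → Bool) := by
    rw [← Cardinal.aleph0_lt_mk_iff]
    simpa using Cardinal.cantor Cardinal.aleph0
  exact hf.uncountable

end PartialSums

/-! ### Cylinder sets and the invariant measure -/

section Cylinders

variable {l : ℕ → ℕ}

/-- The sets of series with prescribed initial segment. -/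
def cylinders (l : ℕ → ℕ) : Set (Set (AdicSeries l)) :=
  {A | ∃ n k, A = {x | partialSum x n = k}}

lemma measurable_partialSum (n : ℕ) : Measurable fun x : AdicSeries l => partialSum x n := by
  unfold partialSum
  refine Finset.measurable_sum _ fun i _ => ?_
  exact (Measurable.of_discrete (f := fun d : Fin (l i) => (d : ℕ) * place l i)).comp
    (measurable_pi_apply i)

lemma measurableSet_cylinder (n k : ℕ) : MeasurableSet {x : AdicSeries l | partialSum x n = k} :=
  measurable_partialSum n (measurableSet_singleton k)

lemma generateFrom_cylinders : MeasurableSpace.pi = MeasurableSpace.generateFrom (cylinders l) := by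
  apply le_antisymm
  · refine iSup_le fun i => ?_
    rintro _ ⟨s, -, rfl⟩
    have : (fun x : AdicSeries l => x i) ⁻¹' s =
        ⋃ k ∈ {k | ∃ d ∈ s, k / place l i = (d : ℕ)}, {x | partialSum x (i + 1) = k} := by
      ext x
      simp only [Set.mem_preimage, Set.mem_ofPred_eq, Set.mem_iUnion, exists_prop]
      constructor
      · exact fun h => ⟨_, ⟨x i, h, partialSum_succ_div x i⟩, rfl⟩
      · rintro ⟨k, ⟨d, hd, hk⟩, rfl⟩
        rw [partialSum_succ_div] at hk
        rwa [Fin.ext hk]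
    rw [this]
    exact MeasurableSet.biUnion (Set.to_countable _) fun k _ =>
      MeasurableSpace.measurableSet_generateFrom ⟨_, _, rfl⟩
  · refine MeasurableSpace.generateFrom_le ?_
    rintro _ ⟨n, k, rfl⟩
    exact measurableSet_cylinder n k

lemma isPiSystem_cylinders : IsPiSystem (cylinders l) := by
  have key : ∀ n m k j, n ≤ m →
      ({x : AdicSeries l | partialSum x n = k} ∩ {x | partialSum x m = j}).Nonempty →
      {x : AdicSeries l | partialSum x n = k} ∩ {x | partialSum x m = j} ∈ cylinders l := by
    rintro n m k j hnm ⟨z, rfl, rfl⟩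
    refine ⟨m, partialSum z m, Set.inter_eq_right.2 fun x hx => ?_⟩
    exact partialSum_eq_iff.2 fun i hi => partialSum_eq_iff.1 hx i (hi.trans_le hnm)
  rintro _ ⟨n, k, rfl⟩ _ ⟨m, j, rfl⟩ h
  rcases le_total n m with hnm | hnm
  · exact key n m k j hnm h
  · rw [Set.inter_comm] at h ⊢
    exact key m n j k hnm h

/-- Under the product of uniform measures all cylinders of a given length have the same mass, and
adding `1` permutes them. -/
lemma exists_invariant_measure (hl : ∀ i, 2 ≤ l i) :
    ∃ μ : Measure (AdicSeries l), IsProbabilityMeasure μ ∧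
      MeasurePreserving (odometerEquiv hl) μ μ := by
  have hne : ∀ i, NeZero (l i) := fun i => ⟨by have := hl i; omega⟩
  let u : ∀ i, Measure (Fin (l i)) := fun i => (PMF.uniformOfFintype (Fin (l i))).toMeasure
  let μ : Measure (AdicSeries l) := Measure.infinitePi u
  have hμ : ∀ (z : AdicSeries l) n, μ {x | partialSum x n = partialSum z n} =
      ∏ i ∈ range n, (l i : ENNReal)⁻¹ := by
    intro z n
    have : {x : AdicSeries l | partialSum x n = partialSum z n} =
        Set.pi (range n) fun i => {z i} := by
      ext x
      simp [partialSum_eq_iff, Set.mem_pi]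
    rw [this, Measure.infinitePi_pi _ fun i _ => measurableSet_singleton _]
    refine prod_congr rfl fun i _ => ?_
    rw [PMF.toMeasure_apply_singleton _ _ (measurableSet_singleton _)]
    simp
  refine ⟨μ, inferInstance, (odometerEquiv hl).measurable, ?_⟩
  refine ext_of_generate_finite _ generateFrom_cylinders isPiSystem_cylinders ?_ ?_
  · rintro _ ⟨n, k, rfl⟩
    rw [Measure.map_apply (odometerEquiv hl).measurable (measurableSet_cylinder n k)]
    by_cases h : ∃ z, partialSum (odometerEquiv hl z) n = k
    · obtain ⟨z, rfl⟩ := h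
      have : odometerEquiv hl ⁻¹' {x | partialSum x n = partialSum (odometerEquiv hl z) n} =
          {x | partialSum x n = partialSum z n} := by
        ext x
        simp only [Set.mem_preimage, Set.mem_ofPred_eq]
        have hx := partialSum_odometerEquiv_modEq hl x n
        have hz := partialSum_odometerEquiv_modEq hl z n
        constructor
        · intro h
          rw [h] at hx
          exact (Nat.ModEq.add_right_cancel' 1 (hx.symm.trans hz)).eq_of_lt_of_lt
            (partialSum_lt _ _) (partialSum_lt _ _)
        · intro h
          rw [h] at hx
          exact (hx.trans hz.symm).eq_of_lt_of_lt (partialSum_lt _ _) (partialSum_lt _ _)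
      rw [this, hμ, hμ]
    -- Translation is onto, so a value it never produces is not a partial sum at all: both sets are
    -- empty.
    · have h' : ∀ z : AdicSeries l, partialSum z n ≠ k := fun z hz =>
        h ⟨(odometerEquiv hl).symm z, by simpa using hz⟩
      simp [h']
  · rw [Measure.map_apply (odometerEquiv hl).measurable MeasurableSet.univ, Set.preimage_univ]

end Cylinders

/-! ### Recurrence and Borel transversals -/

section Transversals

variable {X : Type*} [MeasurableSpace X] {T : X ≃ᵐ X}

/-- An aperiodic automorphism preserving a probability measure has no Borel transversal. -/
lemma not_isSmooth_of_measurePreserving (hT : IsAperiodic T) {μ : Measure X}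
    [IsProbabilityMeasure μ] (hμ : MeasurePreserving T μ μ) : ¬ IsSmooth T := by
  rintro ⟨A, hA, hu⟩
  have h0 : μ A = 0 := by
    by_contra h0
    -- Poincaré recurrence: some point of `A` returns to `A`, and a transversal only allows it to
    -- return to itself.
    obtain ⟨x, hx, m, hm, hmx⟩ := hμ.conservative.exists_mem_iterate_mem hA.nullMeasurableSet h0
    have hs : Equiv.Perm.SameCycle T.toEquiv x ((T : X → X)^[m] x) :=
      ⟨m, by rw [zpow_natCast, Equiv.Perm.coe_pow]; rfl⟩
    have := (hu x).unique ⟨hmx, hs⟩ ⟨hx, Equiv.Perm.SameCycle.refl _ _⟩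
    exact hT x ⟨m, Nat.pos_of_ne_zero hm, this⟩
  have hz : ∀ i : ℤ, μ ((T.toEquiv ^ i : Equiv.Perm X) ⁻¹' A) = 0 := by
    intro i
    obtain ⟨n, rfl | rfl⟩ := i.eq_nat_or_neg
    · rw [zpow_natCast, Equiv.Perm.coe_pow]
      exact ((hμ.iterate n).measure_preimage hA.nullMeasurableSet).trans h0
    · rw [zpow_neg, zpow_natCast, ← inv_pow, Equiv.Perm.coe_pow]
      exact (((hμ.symm T).iterate n).measure_preimage hA.nullMeasurableSet).trans h0
  have huniv : (Set.univ : Set X) ⊆ ⋃ i : ℤ, (T.toEquiv ^ i : Equiv.Perm X) ⁻¹' A := by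
    intro x _
    obtain ⟨y, ⟨hy, i, rfl⟩, -⟩ := hu x
    exact Set.mem_iUnion.2 ⟨i, hy⟩
  have := measure_mono_null huniv (measure_iUnion_null hz)
  simp at this

lemma iterate_symm_cancel (T : X ≃ᵐ X) (n : ℕ) (x : X) :
    (T : X → X)^[n] ((T.symm : X → X)^[n] x) = x :=
  Function.LeftInverse.iterate T.apply_symm_apply n x

lemma injective_iterate (T : X ≃ᵐ X) (n : ℕ) : Function.Injective (T : X → X)^[n] :=
  T.injective.iterate n

lemma measurableSet_image_iterate (T : X ≃ᵐ X) (n : ℕ) {A : Set X} (hA : MeasurableSet A) :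
    MeasurableSet ((T : X → X)^[n] '' A) := by
  induction n generalizing A with
  | zero => simpa
  | succ n ih =>
    rw [Function.iterate_succ, Set.image_comp]
    exact ih (T.measurableSet_image.2 hA)

end Transversals

/-! ### Odometers have rank one -/

section OdometerRank

variable {X : Type*} [MeasurableSpace X] {l : ℕ → ℕ} {hl : ∀ i, 2 ≤ l i} {S : X ≃ᵐ X}
  {e : X ≃ᵐ AdicSeries l}

lemma partialSum_iterate_modEq (he : ∀ x, e (S x) = odometerEquiv hl (e x)) (n k : ℕ) (x : X) :
    partialSum (e ((S : X → X)^[k] x)) n ≡ partialSum (e x) n + k [MOD place l n] := by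
  induction k with
  | zero => rfl
  | succ k ih =>
    rw [Function.iterate_succ_apply', he]
    exact (partialSum_odometerEquiv_modEq hl _ n).trans (ih.add_right 1)

/-- A period `k` would be divisible by `place l k`, which is at least `2 ^ k > k`. -/
lemma isAperiodic_of_conj (he : ∀ x, e (S x) = odometerEquiv hl (e x)) : IsAperiodic S := by
  rintro x ⟨k, hk, hx⟩
  have h := partialSum_iterate_modEq he k k x
  rw [show (S : X → X)^[k] x = x from hx] at h
  have h0 : k ≡ 0 [MOD place l k] := (Nat.ModEq.add_left_cancel' (partialSum (e x) k) h).symm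
  have := Nat.le_of_dvd hk ((Nat.modEq_zero_iff_dvd).1 h0)
  have := two_pow_le_place hl k
  have := k.lt_two_pow_self
  omega

lemma not_isSmooth_of_conj (he : ∀ x, e (S x) = odometerEquiv hl (e x)) : ¬ IsSmooth S := by
  obtain ⟨μ, hμ, hp⟩ := exists_invariant_measure hl
  have h1 : MeasurePreserving e.symm μ (μ.map e.symm) := e.symm.measurable.measurePreserving μ
  have h2 : MeasurePreserving e (μ.map e.symm) μ := h1.symm e.symm
  have : IsProbabilityMeasure (μ.map e.symm) :=
    Measure.isProbabilityMeasure_map e.symm.measurable.aemeasurable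
  have hS : (S : X → X) = e.symm ∘ odometerEquiv hl ∘ e := by
    funext x
    simp [← he]
  refine not_isSmooth_of_measurePreserving (isAperiodic_of_conj he) (μ := μ.map e.symm) ?_
  rw [hS]
  exact h1.comp (hp.comp h2)

lemma image_iterate_cylinder (he : ∀ x, e (S x) = odometerEquiv hl (e x)) {n k : ℕ}
    (hk : k < place l n) :
    (S : X → X)^[k] '' {x | partialSum (e x) n = 0} = {x | partialSum (e x) n = k} := by
  ext x
  constructor
  · rintro ⟨y, hy, rfl⟩
    have h := partialSum_iterate_modEq he n k y
    rw [show partialSum (e y) n = 0 from hy, zero_add] at h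
    exact h.eq_of_lt_of_lt (partialSum_lt _ _) hk
  · intro hx
    refine ⟨(S.symm : X → X)^[k] x, ?_, iterate_symm_cancel S k x⟩
    have h := partialSum_iterate_modEq he n k ((S.symm : X → X)^[k] x)
    rw [iterate_symm_cancel, show partialSum (e x) n = k from hx] at h
    have h0 : 0 ≡ partialSum (e ((S.symm : X → X)^[k] x)) n [MOD place l n] :=
      Nat.ModEq.add_right_cancel' k (by simpa using h)
    exact (h0.eq_of_lt_of_lt (place_pos (e x) n) (partialSum_lt _ _)).symm

lemma uncountable_cylinder (he : ∀ x, e (S x) = odometerEquiv hl (e x)) (n : ℕ) :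
    ¬ {x | partialSum (e x) n = 0}.Countable := by
  intro h
  have : (Set.univ : Set X).Countable := by
    have hc : (⋃ k : ℕ, (S : X → X)^[k] '' {x | partialSum (e x) n = 0}).Countable :=
      Set.countable_iUnion fun k => h.image _
    refine hc.mono fun x _ => Set.mem_iUnion.2 ⟨partialSum (e x) n, ?_⟩
    rw [image_iterate_cylinder he (partialSum_lt _ _)]
    rfl
  have hX : Countable X := Set.countable_univ_iff.1 this
  have := uncountable_adicSeries hl
  exact not_countable (e.symm.injective.countable)

/-- The tower of an odometer whose levels are the cylinders of length `n`. -/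
def odometerTower (he : ∀ x, e (S x) = odometerEquiv hl (e x)) (n : ℕ) : Multitower S where
  J := Unit
  countable_J := inferInstance
  base _ := {x | partialSum (e x) n = 0}
  top _ := place l n - 1
  measurable_base _ := e.measurable (measurableSet_cylinder n 0)
  uncountable_base _ := uncountable_cylinder he n
  disjoint_levels := by
    rintro ⟨⟩ i ⟨⟩ i' hi hi' h
    have hp : 0 < place l n := (Nat.two_pow_pos n).trans_le (two_pow_le_place hl n)
    rw [image_iterate_cylinder he (by omega), image_iterate_cylinder he (by omega)]
    rw [Set.disjoint_left]
    rintro x rfl rfl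
    simp at h

lemma atoms_odometerTower (he : ∀ x, e (S x) = odometerEquiv hl (e x)) (n : ℕ) :
    (odometerTower he n).atoms = {A | ∃ k < place l n, A = {x | partialSum (e x) n = k}} := by
  have hp : 0 < place l n := (Nat.two_pow_pos n).trans_le (two_pow_le_place hl n)
  ext A
  constructor
  · rintro ⟨⟨⟩, i, hi, rfl⟩
    have hi' : i < place l n := by change i ≤ place l n - 1 at hi; omega
    exact ⟨i, hi', image_iterate_cylinder he hi'⟩
  · rintro ⟨k, hk, rfl⟩
    exact ⟨(), k, by change k ≤ place l n - 1; omega, (image_iterate_cylinder he hk).symm⟩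

lemma hasRankAtMost_one_of_conj (he : ∀ x, e (S x) = odometerEquiv hl (e x)) :
    HasRankAtMost S 1 := by
  refine ⟨isAperiodic_of_conj he, not_isSmooth_of_conj he, odometerTower he, fun n => ?_,
    fun n => ?_, ?_, ?_⟩
  · change ENat.card Unit ≤ _
    simp
  · intro A hA
    rw [atoms_odometerTower] at hA
    obtain ⟨k, hk, rfl⟩ := hA
    rw [atoms_odometerTower]
    refine ⟨{A | ∃ j < place l (n + 1), j % place l n = k ∧ A = {x | partialSum (e x) (n + 1) = j}},
      fun A ⟨j, hj, _, h⟩ => ⟨j, hj, h⟩, ?_⟩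
    ext x
    simp only [Set.mem_ofPred_eq, Set.mem_sUnion]
    constructor
    · rintro rfl
      exact ⟨_, ⟨_, partialSum_lt (e x) (n + 1), partialSum_succ_mod _ _, rfl⟩, rfl⟩
    · rintro ⟨_, ⟨j, hj, rfl, rfl⟩, hx⟩
      rw [← partialSum_succ_mod, show partialSum (e x) (n + 1) = j from hx]
  · refine Set.eq_univ_of_forall fun x => Set.mem_iUnion.2 ⟨0, {y | partialSum (e y) 0 = 0}, ?_, ?_⟩
    · rw [atoms_odometerTower]
      exact ⟨0, by simp [place], rfl⟩
    · simp [partialSum]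
  · apply le_antisymm
    · refine MeasurableSpace.generateFrom_le fun A hA => ?_
      obtain ⟨n, hn⟩ := Set.mem_iUnion.1 hA
      rw [atoms_odometerTower] at hn
      obtain ⟨k, -, rfl⟩ := hn
      exact e.measurable (measurableSet_cylinder n k)
    · refine e.measurableEmbedding.comap_eq.ge.trans
        ((MeasurableSpace.comap_mono generateFrom_cylinders.le).trans ?_)
      rw [MeasurableSpace.comap_generateFrom]
      refine MeasurableSpace.generateFrom_le ?_
      rintro _ ⟨_, ⟨n, k, rfl⟩, rfl⟩
      by_cases hk : k < place l n
      · refine MeasurableSpace.measurableSet_generateFrom (Set.mem_iUnion.2 ⟨n, ?_⟩)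
        rw [atoms_odometerTower]
        exact ⟨k, hk, rfl⟩
      -- `cylinders` does not bound `k`; the cylinders beyond the range are empty rather than atoms.
      · have : e ⁻¹' {x | partialSum x n = k} = ∅ :=
          Set.eq_empty_of_forall_notMem fun x (hx : partialSum (e x) n = k) =>
            hk (hx ▸ partialSum_lt (e x) n)
        rw [this]
        exact @MeasurableSet.empty X (MeasurableSpace.generateFrom _)

/-- On the empty space the empty set is vacuously a transversal. -/
lemma nonempty_of_hasRankAtMost {T : X ≃ᵐ X} {r : ℕ} (h : HasRankAtMost T r) : Nonempty X := by
  by_contra hX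
  rw [not_nonempty_iff] at hX
  exact h.2.1 ⟨∅, MeasurableSet.empty, fun x => isEmptyElim x⟩

lemma not_hasRankAtMost_zero (T : X ≃ᵐ X) : ¬ HasRankAtMost T 0 := by
  intro h
  obtain ⟨x⟩ := nonempty_of_hasRankAtMost h
  obtain ⟨-, -, η, hr, -, hs, -⟩ := h
  obtain ⟨n, A, ⟨j, -⟩, -⟩ := Set.mem_iUnion.1 (hs.symm.subset (Set.mem_univ x))
  have := hr n
  rw [Multitower.rank, Nat.cast_zero, nonpos_iff_eq_zero, ENat.card_eq_zero_iff_empty] at this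
  exact this.false j

variable (X) in
/-- Odometers have rank one. -/
lemma odometers_subset_rankSet_one : odometers X ⊆ rankSet X 1 := by
  rintro S ⟨l, hl, e, he⟩
  refine ⟨hasRankAtMost_one_of_conj (hl := hl) he, fun s hs => ?_⟩
  obtain rfl : s = 0 := by omega
  exact not_hasRankAtMost_zero S

end OdometerRank

/-! ### Standard Borel preliminaries -/

section StandardBorel

lemma standardBorelSpace_sum (Y Z : Type*) [MeasurableSpace Y] [MeasurableSpace Z]
    [StandardBorelSpace Y] [StandardBorelSpace Z] : StandardBorelSpace (Y ⊕ Z) := by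
  let := upgradeStandardBorel Y
  let := upgradeStandardBorel Z
  have : BorelSpace (Y ⊕ Z) := by
    refine ⟨le_antisymm (fun s hs => ?_) (MeasurableSpace.generateFrom_le fun s hs => ?_)⟩
    · let : MeasurableSpace (Y ⊕ Z) := borel (Y ⊕ Z)
      have : BorelSpace (Y ⊕ Z) := ⟨rfl⟩
      rw [← Set.image_preimage_inl_union_image_preimage_inr s]
      have hl := (Topology.IsOpenEmbedding.inl (X := Y) (Y := Z)).measurableEmbedding
      have hr := (Topology.IsOpenEmbedding.inr (X := Y) (Y := Z)).measurableEmbedding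
      exact (hl.measurableSet_image.2 (measurableSet_sum_iff.1 hs).1).union
        (hr.measurableSet_image.2 (measurableSet_sum_iff.1 hs).2)
    · exact measurableSet_sum_iff.2 ⟨(hs.preimage continuous_inl).measurableSet,
        (hs.preimage continuous_inr).measurableSet⟩
  infer_instance

open Classical in
/-- The transposition of two points, as an automorphism. -/
noncomputable def measurableSwap {X : Type*} [MeasurableSpace X] [MeasurableSingletonClass X]
    (a b : X) : X ≃ᵐ X where
  toEquiv := Equiv.swap a b
  measurable_toFun := Measurable.ite (measurableSet_singleton a) measurable_const
    (Measurable.ite (measurableSet_singleton b) measurable_const measurable_id)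
  measurable_invFun := Measurable.ite (measurableSet_singleton a) measurable_const
    (Measurable.ite (measurableSet_singleton b) measurable_const measurable_id)

lemma exists_measurableEquiv_map_pair {Y Z : Type*} [MeasurableSpace Y] [StandardBorelSpace Y]
    [MeasurableSpace Z] [StandardBorelSpace Z] [Uncountable Y] [Uncountable Z]
    {a b : Y} (hab : a ≠ b) {c d : Z} (hcd : c ≠ d) : ∃ κ : Y ≃ᵐ Z, κ a = c ∧ κ b = d := by
  classical
  let e : Y ≃ᵐ Z := PolishSpace.measurableEquivOfNotCountable not_countable not_countable
  let f := e.trans (measurableSwap (e a) c)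
  have hfa : f a = c := Equiv.swap_apply_left _ _
  have hfb : c ≠ f b := fun h => hab (f.injective (hfa.trans h))
  refine ⟨f.trans (measurableSwap (f b) d), ?_, Equiv.swap_apply_left _ _⟩
  change Equiv.swap (f b) d (f a) = c
  rw [hfa]
  exact Equiv.swap_apply_of_ne_of_ne hfb hcd

/-- A measurable bijection between standard Borel spaces is an isomorphism. -/
noncomputable def measurableEquivOfBijective {Y Z : Type*} [MeasurableSpace Y]
    [StandardBorelSpace Y] [MeasurableSpace Z] [StandardBorelSpace Z] (f : Y → Z)
    (hf : Measurable f) (hb : Function.Bijective f) : Y ≃ᵐ Z where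
  toEquiv := Equiv.ofBijective f hb
  measurable_toFun := hf
  measurable_invFun := by
    -- Lusin–Souslin: injective Borel maps between standard Borel spaces send Borel sets to Borel
    -- sets.
    have he := hf.measurableEmbedding hb.injective
    intro s hs
    rw [← Equiv.image_eq_preimage_symm]
    exact he.measurableSet_image.2 hs

/-- `B` is isomorphic to `ℕ × ℝ`, so it splits into countably many uncountable pieces, whose
measures are summable. -/
lemma exists_uncountable_subset_measure_lt {X : Type*} [MeasurableSpace X] [StandardBorelSpace X]
    {B : Set X} (hB : MeasurableSet B) (hu : ¬ B.Countable) (ν : Measure X) [IsFiniteMeasure ν]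
    {ε : ENNReal} (hε : ε ≠ 0) :
    ∃ A ⊆ B, MeasurableSet A ∧ ¬ A.Countable ∧ ν A < ε := by
  have := hB.standardBorel
  have hprod : ¬ Countable (ℕ × ℝ) := fun h =>
    not_countable (α := ℝ) ((Prod.mk_right_injective 0).countable)
  let e : ℕ × ℝ ≃ᵐ B := PolishSpace.measurableEquivOfNotCountable hprod hu
  let f : ℕ → ℝ → X := fun n r => e (n, r)
  have hf : ∀ n, Function.Injective (f n) := fun n r s h => by
    simpa using e.injective (Subtype.ext h)
  have hm : ∀ n, Measurable (f n) := fun n =>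
    measurable_subtype_coe.comp (e.measurable.comp measurable_prodMk_left)
  have hr : ∀ n, MeasurableSet (Set.range (f n)) := fun n =>
    ((hm n).measurableEmbedding (hf n)).measurableSet_range
  have hd : Pairwise (Function.onFun Disjoint fun n => Set.range (f n)) := by
    intro i j hij
    refine Set.disjoint_left.2 ?_
    rintro _ ⟨r, rfl⟩ ⟨s, hs⟩
    have := e.injective (Subtype.ext hs)
    simp only [Prod.mk.injEq] at this
    exact hij this.1.symm
  have hsum : ∑' n, ν (Set.range (f n)) ≠ ⊤ := by
    rw [← measure_iUnion hd hr]
    exact measure_ne_top _ _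
  obtain ⟨n, hn⟩ := ((ENNReal.tendsto_atTop_zero_of_tsum_ne_top hsum).eventually_lt_const
    (pos_iff_ne_zero.2 hε)).exists
  refine ⟨Set.range (f n), ?_, hr n, fun hc => ?_, hn⟩
  · rintro _ ⟨r, rfl⟩
    exact (e (n, r)).2
  · have : Countable (Set.range (f n)) := hc
    exact not_countable (α := ℝ) ((Set.rangeFactorization_injective.2 (hf n)).countable)

/-- The limit superior of the sets is empty, so continuity from above applies to their tails. -/
lemma eventually_measure_lt_of_not_frequently {X : Type*} [MeasurableSpace X] (ν : Measure X)
    [IsFiniteMeasure ν] {D : ℕ → Set X} (hD : ∀ n, MeasurableSet (D n))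
    (h : ∀ x, ¬ ∃ᶠ n in Filter.atTop, x ∈ D n) {ε : ENNReal} (hε : ε ≠ 0) :
    ∀ᶠ n in Filter.atTop, ν (D n) < ε := by
  let U : ℕ → Set X := fun n => ⋃ k ≥ n, D k
  have hU : ∀ n, NullMeasurableSet (U n) ν := fun n =>
    (MeasurableSet.iUnion fun k => MeasurableSet.iUnion fun _ => hD k).nullMeasurableSet
  have hanti : Antitone U := fun i j hij =>
    Set.iUnion_mono fun k => Set.iUnion_mono' fun hk => ⟨hij.trans hk, le_rfl⟩
  have hempty : ⋂ n, U n = ∅ := by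
    refine Set.eq_empty_of_forall_notMem fun x hx => h x (Filter.frequently_atTop.2 fun n => ?_)
    have := Set.mem_iInter.1 hx n
    simp only [U, Set.mem_iUnion] at this
    obtain ⟨k, hk, hxk⟩ := this
    exact ⟨k, hk, hxk⟩
  have ht := tendsto_measure_iInter_atTop hU hanti ⟨0, measure_ne_top ν _⟩
  rw [hempty, measure_empty] at ht
  filter_upwards [ht.eventually_lt_const (pos_iff_ne_zero.2 hε)] with n hn
  exact (measure_mono (Set.subset_iUnion₂ (s := fun k (_ : k ≥ n) => D k) n le_rfl)).trans_lt hn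

end StandardBorel

/-! ### Extending a tower to an odometer -/

section Extension

/-- The digit bounds `2 * h, 2, 2, …`. -/
def towerDigits (h : ℕ) : ℕ → ℕ
  | 0 => 2 * h
  | _ + 1 => 2

lemma two_le_towerDigits (m i : ℕ) : 2 ≤ towerDigits (m + 1) i := by
  cases i <;> simp only [towerDigits] <;> omega

/-- Splitting off the residue modulo `h` of the first digit. -/
def towerDigitsEquiv (h : ℕ) : (Fin 2 × (ℕ → Fin 2)) × Fin h ≃ᵐ AdicSeries (towerDigits h) where
  toFun p
    | 0 => finProdFinEquiv (p.1.1, p.2)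
    | n + 1 => p.1.2 n
  invFun x := (((finProdFinEquiv.symm (x 0)).1, fun n => x (n + 1)), (finProdFinEquiv.symm (x 0)).2)
  left_inv p := by simp
  right_inv x := by
    funext i
    cases i
    · exact finProdFinEquiv.apply_symm_apply (x 0)
    · rfl
  measurable_toFun := by
    refine measurable_pi_iff.2 fun i => ?_
    cases i with
    | zero =>
      exact (Measurable.of_discrete (f := fun q : Fin 2 × Fin h => finProdFinEquiv q)).comp
        (measurable_fst.fst.prodMk measurable_snd)
    | succ n => exact (measurable_pi_apply n).comp measurable_fst.snd
  measurable_invFun := by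
    have h0 : Measurable fun x : AdicSeries (towerDigits h) =>
        (finProdFinEquiv (m := 2) (n := h)).symm (x 0) :=
      (Measurable.of_discrete (f := fun q : Fin (2 * h) => finProdFinEquiv.symm q)).comp
        (measurable_pi_apply 0)
    exact (h0.fst.prodMk (measurable_pi_iff.2 fun n => measurable_pi_apply (n + 1))).prodMk h0.snd

lemma odometerEquiv_towerDigitsEquiv_of_lt {m : ℕ} (q : Fin 2 × (ℕ → Fin 2)) {i : ℕ} (hi : i < m) :
    odometerEquiv (two_le_towerDigits m) (towerDigitsEquiv (m + 1) (q, ⟨i, by omega⟩)) =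
      towerDigitsEquiv (m + 1) (q, ⟨i + 1, by omega⟩) := by
  refine odometerEquiv_eq_of_lt _ ?_ fun i => rfl
  change ((finProdFinEquiv (q.1, (⟨i + 1, by omega⟩ : Fin (m + 1))) : Fin _) : ℕ) =
    (finProdFinEquiv (q.1, (⟨i, by omega⟩ : Fin (m + 1))) : Fin _) + 1
  simp only [finProdFinEquiv_apply_val]
  omega

lemma odometerEquiv_towerDigitsEquiv_top {m : ℕ} (z : ℕ → Fin 2) :
    odometerEquiv (two_le_towerDigits m) (towerDigitsEquiv (m + 1) ((0, z), ⟨m, by omega⟩)) =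
      towerDigitsEquiv (m + 1) ((1, z), ⟨0, by omega⟩) := by
  refine odometerEquiv_eq_of_lt _ ?_ fun i => rfl
  change ((finProdFinEquiv ((1 : Fin 2), (⟨0, by omega⟩ : Fin (m + 1))) : Fin _) : ℕ) =
    (finProdFinEquiv ((0 : Fin 2), (⟨m, by omega⟩ : Fin (m + 1))) : Fin _) + 1
  simp [finProdFinEquiv_apply_val]

variable {X : Type*} [MeasurableSpace X] [StandardBorelSpace X]

/-- Given a tower over `B` and an uncountable `A ⊆ B`, there is an odometer that agrees with `T`
below the top of the tower over `B \ A` and takes a given point of its top to a given point of its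
base. -/
lemma exists_odometer_of_tower (T : X ≃ᵐ X) {B A : Set X} {m : ℕ} (hB : MeasurableSet B)
    (hdisj : ∀ i i', i ≤ m → i' ≤ m → i ≠ i' →
      Disjoint ((T : X → X)^[i] '' B) ((T : X → X)^[i'] '' B))
    (hA : MeasurableSet A) (hAB : A ⊆ B) (hAu : ¬ A.Countable)
    {a b : X} (ha : a ∈ B \ A) (hb : b ∈ B \ A) (hab : a ≠ b) :
    ∃ S ∈ odometers X, (∀ x ∈ B \ A, ∀ i < m, S ((T : X → X)^[i] x) = (T : X → X)^[i + 1] x) ∧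
      S ((T : X → X)^[m] a) = b := by
  have hB' : MeasurableSet (B \ A) := hB.diff hA
  -- All that the shortened tower misses; it contains `A`, hence is uncountable.
  let C : Set X := (⋃ i : Fin (m + 1), (T : X → X)^[(i : ℕ)] '' (B \ A))ᶜ
  have hC : MeasurableSet C :=
    (MeasurableSet.iUnion fun i : Fin (m + 1) => measurableSet_image_iterate T i hB').compl
  have hAC : A ⊆ C := by
    intro x hx hmem
    obtain ⟨i, y, hy, rfl⟩ := Set.mem_iUnion.1 hmem
    by_cases hi : (i : ℕ) = 0
    · simp only [hi, Function.iterate_zero, id] at hx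
      exact hy.2 hx
    · exact Set.disjoint_left.1 (hdisj i 0 (by omega) (by omega) hi) ⟨y, hy.1, rfl⟩
        ⟨_, hAB hx, rfl⟩
  have hCu : ¬ C.Countable := fun h => hAu (h.mono hAC)
  have := hB'.standardBorel
  have := hC.standardBorel
  have hprod : ¬ Countable (ℝ × Fin (m + 1)) := fun h =>
    not_countable (α := ℝ) ((Prod.mk_left_injective (0 : Fin (m + 1))).countable)
  let c : ℝ × Fin (m + 1) ≃ᵐ C := PolishSpace.measurableEquivOfNotCountable hprod hCu
  let Φ : (↥(B \ A) ⊕ ℝ) × Fin (m + 1) → X := fun p =>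
    Sum.elim (fun y : ↥(B \ A) => (T : X → X)^[(p.2 : ℕ)] y) (fun r => (c (r, p.2) : X)) p.1
  have hΦm : Measurable Φ := by
    refine measurable_from_prod_countable_left fun i => ?_
    refine Measurable.sumElim ?_ ?_
    · exact (T.measurable.iterate (i : ℕ)).comp measurable_subtype_coe
    · exact measurable_subtype_coe.comp (c.measurable.comp measurable_prodMk_right)
  have hlevel : ∀ (y : ↥(B \ A)) (i : Fin (m + 1)) (z : C), (T : X → X)^[(i : ℕ)] y ≠ z := by
    intro y i z h
    exact z.2 (Set.mem_iUnion.2 ⟨i, y, y.2, h⟩)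
  have hΦi : Function.Injective Φ := by
    rintro ⟨y | r, i⟩ ⟨y' | r', i'⟩ h
    · have h' : (T : X → X)^[(i : ℕ)] y = (T : X → X)^[(i' : ℕ)] y' := h
      obtain rfl : i = i' := by
        by_contra hne
        exact Set.disjoint_left.1 (hdisj i i' (by omega) (by omega) (fun h => hne (Fin.ext h)))
          ⟨y, y.2.1, rfl⟩ ⟨y', y'.2.1, h'.symm⟩
      rw [Subtype.ext (injective_iterate T i h')]
    · exact absurd h (hlevel y i _)
    · exact absurd h.symm (hlevel y' i' _)
    · have := c.injective (Subtype.ext h)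
      simp only [Prod.mk.injEq] at this
      rw [this.1, this.2]
  have hΦs : Function.Surjective Φ := by
    intro x
    by_cases hx : x ∈ C
    · refine ⟨(Sum.inr (c.symm ⟨x, hx⟩).1, (c.symm ⟨x, hx⟩).2), ?_⟩
      change ((c (c.symm ⟨x, hx⟩) : C) : X) = x
      rw [c.apply_symm_apply]
    · obtain ⟨i, y, hy, rfl⟩ := Set.mem_iUnion.1 (Set.notMem_compl_iff.1 hx)
      exact ⟨(Sum.inl ⟨y, hy⟩, i), rfl⟩
  have := standardBorelSpace_sum ↥(B \ A) ℝ
  let Ψ := measurableEquivOfBijective Φ hΦm ⟨hΦi, hΦs⟩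
  have hΨ : ∀ (y : ↥(B \ A)) (i : Fin (m + 1)), Ψ (Sum.inl y, i) = (T : X → X)^[(i : ℕ)] y :=
    fun _ _ => rfl
  have : Uncountable (↥(B \ A) ⊕ ℝ) := (Sum.inr_injective (α := ↥(B \ A)) (β := ℝ)).uncountable
  have : Uncountable (ℕ → Fin 2) := uncountable_adicSeries (l := fun _ => 2) fun _ => le_rfl
  have : Uncountable (Fin 2 × (ℕ → Fin 2)) :=
    (Prod.mk_right_injective (β := ℕ → Fin 2) (0 : Fin 2)).uncountable
  -- The first digit is `i + (m + 1) * q` for level `i` and first coordinate `q`. The labels of `a`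
  -- and `b` differ only in `q`, so adding `1` at the top of column `a` leads without carry to the
  -- bottom of column `b`.
  obtain ⟨κ, hκa, hκb⟩ := exists_measurableEquiv_map_pair
    (a := (Sum.inl ⟨a, ha⟩ : ↥(B \ A) ⊕ ℝ)) (b := Sum.inl ⟨b, hb⟩) (by simpa using hab)
    (c := ((0 : Fin 2), (0 : ℕ → Fin 2))) (d := (1, 0)) (by simp)
  let e : X ≃ᵐ AdicSeries (towerDigits (m + 1)) :=
    (Ψ.symm.trans (κ.prodCongr (MeasurableEquiv.refl _))).trans (towerDigitsEquiv (m + 1))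
  have he : ∀ (y : ↥(B \ A)) (i : ℕ) (hi : i < m + 1),
      e ((T : X → X)^[i] y) = towerDigitsEquiv (m + 1) (κ (Sum.inl y), ⟨i, hi⟩) := by
    intro y i hi
    have : Ψ.symm ((T : X → X)^[i] y) = (Sum.inl y, ⟨i, hi⟩) := by
      rw [← hΨ y ⟨i, hi⟩, MeasurableEquiv.symm_apply_apply]
    change towerDigitsEquiv (m + 1) ((κ.prodCongr (MeasurableEquiv.refl _))
      (Ψ.symm ((T : X → X)^[i] y))) = _
    rw [this]
    rfl
  let S : X ≃ᵐ X := (e.trans (odometerEquiv (two_le_towerDigits m))).trans e.symm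
  have hS : ∀ x, e (S x) = odometerEquiv (two_le_towerDigits m) (e x) := fun x =>
    e.apply_symm_apply _
  refine ⟨S, ⟨_, two_le_towerDigits m, e, hS⟩, fun x hx i hi => e.injective ?_, e.injective ?_⟩
  · rw [hS, he ⟨x, hx⟩ i (by omega), he ⟨x, hx⟩ (i + 1) (by omega),
      odometerEquiv_towerDigitsEquiv_of_lt _ hi]
  · rw [hS, he ⟨a, ha⟩ m (by omega), hκa, odometerEquiv_towerDigitsEquiv_top]
    rw [← hκb]
    exact (he ⟨b, hb⟩ 0 (by omega)).symm

end Extension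

open Filter

/-! ### Towers of an automorphism of rank one -/

section RankOne

variable {X : Type*}

/-- The union of the levels `B, f B, …, f^[m] B`. -/
def towerSupport (f : X → X) (B : Set X) (m : ℕ) : Set X := {x | ∃ i ≤ m, x ∈ f^[i] '' B}

variable [MeasurableSpace X]

lemma measurableSet_towerSupport (T : X ≃ᵐ X) {B : Set X} (hB : MeasurableSet B) (m : ℕ) :
    MeasurableSet (towerSupport T B m) := by
  have : towerSupport T B m = ⋃ i ≤ m, (T : X → X)^[i] '' B := by
    ext x
    simp [towerSupport]
  rw [this]
  exact MeasurableSet.iUnion fun i => MeasurableSet.iUnion fun _ =>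
    measurableSet_image_iterate T i hB

lemma Multitower.Refines.exists_atom {T : X ≃ᵐ X} {η' η : Multitower T} (h : η'.Refines η)
    {A : Set X} (hA : A ∈ η.atoms) {x : X} (hx : x ∈ A) : ∃ C ∈ η'.atoms, x ∈ C ∧ C ⊆ A := by
  obtain ⟨𝒞, h𝒞, rfl⟩ := h A hA
  obtain ⟨C, hC, hxC⟩ := hx
  exact ⟨C, h𝒞 hC, hxC, Set.subset_sUnion_of_mem hC⟩

/-- A sequence of towers, each with levels pairwise disjoint, with increasing supports that cover
the space, such that distinct points are eventually in distinct levels. -/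
structure IsExhaustingTowers (T : X ≃ᵐ X) (B : ℕ → Set X) (m : ℕ → ℕ) : Prop where
  measurable : ∀ n, MeasurableSet (B n)
  uncountable : ∀ n, ¬ (B n).Countable
  disjoint : ∀ n i i', i ≤ m n → i' ≤ m n → i ≠ i' →
    Disjoint ((T : X → X)^[i] '' B n) ((T : X → X)^[i'] '' B n)
  eventually_mem : ∀ x, ∀ᶠ n in atTop, x ∈ towerSupport T (B n) (m n)
  separates : ∀ x y,
    (∃ᶠ n in atTop, ∃ i ≤ m n, x ∈ (T : X → X)^[i] '' B n ∧ y ∈ (T : X → X)^[i] '' B n) → x = y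

lemma HasRankAtMost.exists_isExhaustingTowers [MeasurableSingletonClass X] {T : X ≃ᵐ X}
    (h : HasRankAtMost T 1) : ∃ B m, IsExhaustingTowers T B m := by
  obtain ⟨x₀⟩ := nonempty_of_hasRankAtMost h
  obtain ⟨-, -, η, hr, href, hs, hgen⟩ := h
  have hatom : ∀ k n, k ≤ n → ∀ A ∈ (η k).atoms, ∀ x ∈ A, ∃ C ∈ (η n).atoms, x ∈ C ∧ C ⊆ A := by
    intro k n hkn
    induction n, hkn using Nat.le_induction with
    | base => exact fun A hA x hx => ⟨A, hA, hx, le_rfl⟩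
    | succ n _ ih =>
      intro A hA x hx
      obtain ⟨C, hC, hxC, hCA⟩ := ih A hA x hx
      obtain ⟨D, hD, hxD, hDC⟩ := (href n).exists_atom hC hxC
      exact ⟨D, hD, hxD, hDC.trans hCA⟩
  have hmem : ∀ x, ∃ k, ∀ n, k ≤ n → ∃ A ∈ (η n).atoms, x ∈ A := by
    intro x
    obtain ⟨k, A, hA, hx⟩ := Set.mem_iUnion.1 (hs.symm.subset (Set.mem_univ x))
    refine ⟨k, fun n hn => ?_⟩
    obtain ⟨C, hC, hxC, -⟩ := hatom k n hn A hA x hx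
    exact ⟨C, hC, hxC⟩
  -- Early multitowers may be empty; from `n₀` on, `x₀` is in the support, so there is exactly one
  -- tower.
  obtain ⟨n₀, hn₀⟩ := hmem x₀
  have hj : ∀ n, ∃ j : (η (n₀ + n)).J, ∀ j', j' = j := by
    intro n
    obtain ⟨A, ⟨j, -⟩, -⟩ := hn₀ (n₀ + n) (by omega)
    have hsub : Subsingleton (η (n₀ + n)).J := by
      rw [← ENat.card_le_one_iff_subsingleton]
      exact_mod_cast hr (n₀ + n)
    exact ⟨j, fun j' => Subsingleton.elim _ _⟩
  choose j hj using hj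
  have hlevel : ∀ n, ∀ A ∈ (η (n₀ + n)).atoms, ∃ i ≤ (η (n₀ + n)).top (j n),
      A = (T : X → X)^[i] '' (η (n₀ + n)).base (j n) := by
    rintro n A ⟨j', i, hi, rfl⟩
    obtain rfl := hj n j'
    exact ⟨i, hi, rfl⟩
  refine ⟨fun n => (η (n₀ + n)).base (j n), fun n => (η (n₀ + n)).top (j n),
    fun n => (η _).measurable_base _, fun n => (η _).uncountable_base _,
    fun n i i' hi hi' hne => (η _).disjoint_levels _ _ _ _ hi hi' (Or.inr hne), fun x => ?_,
    fun x y hxy => ?_⟩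
  · obtain ⟨k, hk⟩ := hmem x
    filter_upwards [eventually_ge_atTop k] with n hn
    obtain ⟨A, hA, hxA⟩ := hk (n₀ + n) (by omega)
    obtain ⟨i, hi, rfl⟩ := hlevel n A hA
    exact ⟨i, hi, hxA⟩
  · have key : ∀ x y, (∃ᶠ n in atTop, ∃ i ≤ (η (n₀ + n)).top (j n),
        x ∈ (T : X → X)^[i] '' (η (n₀ + n)).base (j n) ∧
        y ∈ (T : X → X)^[i] '' (η (n₀ + n)).base (j n)) →
        ∀ k, ∀ A ∈ (η k).atoms, x ∈ A → y ∈ A := by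
      intro x y hxy k A hA hx
      obtain ⟨n, ⟨i, hi, hxi, hyi⟩, hn⟩ := (hxy.and_eventually (eventually_ge_atTop k)).exists
      obtain ⟨C, hC, hxC, hCA⟩ := hatom k (n₀ + n) (by omega) A hA x hx
      obtain ⟨i', hi', rfl⟩ := hlevel n C hC
      by_cases hii : i = i'
      · subst hii
        exact hCA hyi
      · exact absurd hxC (Set.disjoint_left.1
          ((η _).disjoint_levels _ _ _ _ hi hi' (Or.inr hii)) hxi)
    have hyx := hxy.mono fun n ⟨i, hi, h1, h2⟩ =>
      (⟨i, hi, h2, h1⟩ : ∃ i ≤ (η (n₀ + n)).top (j n),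
        y ∈ (T : X → X)^[i] '' (η (n₀ + n)).base (j n) ∧
        x ∈ (T : X → X)^[i] '' (η (n₀ + n)).base (j n))
    -- The sets that do not separate `x` from `y` form a σ-algebra. It contains every atom, hence
    -- all Borel sets, in particular `{x}`.
    have hall : ∀ s : Set X, MeasurableSet[MeasurableSpace.generateFrom (⋃ n, (η n).atoms)] s →
        (x ∈ s ↔ y ∈ s) := by
      intro s hs
      induction s, hs using MeasurableSpace.generateFrom_induction with
      | hC A hA =>
        obtain ⟨k, hk⟩ := Set.mem_iUnion.1 hA
        exact ⟨key x y hxy k A hk, key y x hyx k A hk⟩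
      | empty => rfl
      | compl t _ ih => exact not_congr ih
      | iUnion f _ ih => simp only [Set.mem_iUnion, ih]
    have hx : MeasurableSet[MeasurableSpace.generateFrom (⋃ n, (η n).atoms)] {x} :=
      hgen.ge _ (measurableSet_singleton x)
    exact ((hall {x} hx).1 rfl).symm

/-! ### Choosing a tower with negligible boundary -/

namespace IsExhaustingTowers

variable {T : X ≃ᵐ X} {B : ℕ → Set X} {m : ℕ → ℕ}

/-- If `T x` were on a level above the base, `x` would be on the level below that one, which is not
the top. -/
lemma map_mem_base (h : IsExhaustingTowers T B m) {n : ℕ} {x : X}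
    (hx : x ∈ (T : X → X)^[m n] '' B n) (hTx : T x ∈ towerSupport T (B n) (m n)) : T x ∈ B n := by
  obtain ⟨i, hi, y, hy, hyx⟩ := hTx
  cases i with
  | zero => exact hyx ▸ hy
  | succ i =>
    rw [Function.iterate_succ_apply'] at hyx
    have := T.injective hyx
    exact absurd hx (Set.disjoint_left.1 (h.disjoint n i (m n) (by omega) le_rfl (by omega))
      ⟨y, hy, this⟩)

lemma symm_mem_top (h : IsExhaustingTowers T B m) {n : ℕ} {y : X} (hy : y ∈ B n)
    (hTy : T.symm y ∈ towerSupport T (B n) (m n)) :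
    T.symm y ∈ (T : X → X)^[m n] '' B n := by
  obtain ⟨i, hi, z, hz, hzy⟩ := hTy
  rcases hi.eq_or_lt with rfl | hi
  · exact ⟨z, hz, hzy⟩
  · refine absurd ⟨y, hy, rfl⟩ (Set.disjoint_left.1
      (h.disjoint n (i + 1) 0 hi (by omega) (by omega)) ⟨z, hz, ?_⟩)
    rw [Function.iterate_succ_apply', hzy, T.apply_symm_apply]
    rfl

/-- Some tower has small complement, and small top and base up to a point `T^[m] a` of the top that
`T` takes to a point `b` of the base. -/
lemma exists_measure_lt [MeasurableSingletonClass X] (h : IsExhaustingTowers T B m)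
    (hT : IsAperiodic T) (ν : Measure X) [IsFiniteMeasure ν] {ε : ENNReal} (hε : ε ≠ 0) :
    ∃ n, ∃ a ∈ B n, ∃ b ∈ B n, a ≠ b ∧
      ν ((towerSupport T (B n) (m n))ᶜ ∪
        {x | x ∈ (T : X → X)^[m n] '' B n ∧ ¬ (x = (T : X → X)^[m n] a ∧ T x = b)} ∪
        {x | x ∈ B n ∧ ¬ (T.symm x = (T : X → X)^[m n] a ∧ x = b)}) < ε := by
  have hsupp : ∀ x, ¬ ∃ᶠ n in atTop, x ∈ (towerSupport T (B n) (m n))ᶜ := fun x => by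
    simpa using h.eventually_mem x
  have hmtop : ∀ n, MeasurableSet ((T : X → X)^[m n] '' B n) := fun n =>
    measurableSet_image_iterate T _ (h.measurable n)
  have hmsupp : ∀ n, MeasurableSet (towerSupport T (B n) (m n))ᶜ := fun n =>
    (measurableSet_towerSupport T (h.measurable n) _).compl
  by_cases hx : ∃ x, ∃ᶠ n in atTop, x ∈ (T : X → X)^[m n] '' B n
  · obtain ⟨x, hx⟩ := hx
    have hb : ∀ᶠ n in atTop, x ∈ (T : X → X)^[m n] '' B n → T x ∈ B n := by
      filter_upwards [h.eventually_mem (T x)] with n hn hxn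
      exact h.map_mem_base hxn hn
    -- The top and the base count only for those `n` at which they contain `x` and `T x`; this makes
    -- `separates` applicable to any other point met infinitely often.
    let D : ℕ → Set X := fun n => (towerSupport T (B n) (m n))ᶜ ∪
      {y | x ∈ (T : X → X)^[m n] '' B n ∧ y ∈ (T : X → X)^[m n] '' B n \ {x}} ∪
      {y | T x ∈ B n ∧ y ∈ B n \ {T x}}
    have hD : ∀ n, MeasurableSet (D n) := fun n => ((hmsupp n).union
      ((MeasurableSet.const _).inter ((hmtop n).diff (measurableSet_singleton x)))).union
      ((MeasurableSet.const _).inter ((h.measurable n).diff (measurableSet_singleton (T x))))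
    have hDf : ∀ y, ¬ ∃ᶠ n in atTop, y ∈ D n := by
      intro y hy
      rcases frequently_or_distrib.1 hy with hy | hy
      · rcases frequently_or_distrib.1 hy with hy | hy
        · exact hsupp y hy
        · obtain ⟨n, -, -, hn⟩ := hy.exists
          exact hn (h.separates y x (hy.mono fun n hn => ⟨m n, le_rfl, hn.2.1, hn.1⟩))
      · obtain ⟨n, -, -, hn⟩ := hy.exists
        exact hn (h.separates y (T x) (hy.mono fun n hn =>
          ⟨0, Nat.zero_le _, by simpa using hn.2.1, by simpa using hn.1⟩))
    obtain ⟨n, hxn, hbn, hDn⟩ :=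
      (hx.and_eventually (hb.and (eventually_measure_lt_of_not_frequently ν hD hDf hε))).exists
    obtain ⟨a, ha, hax⟩ := id hxn
    refine ⟨n, a, ha, T x, hbn hxn, fun hne => ?_, (measure_mono ?_).trans_lt hDn⟩
    -- If `T x` were `a`, then `a` would have period `m n + 1`.
    · refine hT a ⟨m n + 1, Nat.succ_pos _, ?_⟩
      change (T : X → X)^[m n + 1] a = a
      rw [Function.iterate_succ_apply', hax, ← hne]
    · rw [hax]
      refine Set.union_subset_union (Set.union_subset_union le_rfl ?_) ?_
      · rintro y ⟨hy, hne⟩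
        exact ⟨hxn, hy, fun hyx => hne ⟨hyx, congrArg T hyx⟩⟩
      · rintro y ⟨hy, hne⟩
        refine ⟨hbn hxn, hy, fun hyx => hne ⟨?_, hyx⟩⟩
        rw [show y = T x from hyx, T.symm_apply_apply]
  · push Not at hx
    let D : ℕ → Set X := fun n => (towerSupport T (B n) (m n))ᶜ ∪ (T : X → X)^[m n] '' B n ∪ B n
    have hD : ∀ n, MeasurableSet (D n) := fun n =>
      ((hmsupp n).union (hmtop n)).union (h.measurable n)
    have hDf : ∀ y, ¬ ∃ᶠ n in atTop, y ∈ D n := by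
      intro y hy
      rcases frequently_or_distrib.1 hy with hy | hy
      · rcases frequently_or_distrib.1 hy with hy | hy
        · exact hsupp y hy
        · exact hy (hx y)
      -- A point in infinitely many bases has its preimage in infinitely many tops.
      · exact ((hy.and_eventually (h.eventually_mem (T.symm y))).mono fun n hn =>
          h.symm_mem_top hn.1 hn.2) (hx (T.symm y))
    obtain ⟨n, hn⟩ := (eventually_measure_lt_of_not_frequently ν hD hDf hε).exists
    have hnt : (B n).Nontrivial := by
      by_contra hnt
      exact h.uncountable n (Set.not_nontrivial_iff.1 hnt).countable
    obtain ⟨a, ha, b, hb, hab⟩ := hnt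
    exact ⟨n, a, ha, b, hb, hab, (measure_mono (Set.union_subset_union
      (Set.union_subset_union le_rfl fun y hy => hy.1) fun y hy => hy.1)).trans_lt hn⟩

end IsExhaustingTowers

/-- An automorphism of rank one is approximated by odometers. -/
lemma HasRankAtMost.exists_odometer_measure_diffSet_lt [StandardBorelSpace X] {T : X ≃ᵐ X}
    (h : HasRankAtMost T 1) (ν : Measure X) [IsFiniteMeasure ν] {ε : ENNReal} (hε : ε ≠ 0) :
    ∃ S ∈ odometers X, ν (diffSet S T) < ε := by
  have hε2 : ε / 2 ≠ 0 := (ENNReal.half_pos hε).ne'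
  obtain ⟨B, m, hBm⟩ := h.exists_isExhaustingTowers
  obtain ⟨n, a, ha, b, hb, hab, hbad⟩ := hBm.exists_measure_lt h.1 ν hε2
  let bad := (towerSupport T (B n) (m n))ᶜ ∪
        {x | x ∈ (T : X → X)^[m n] '' B n ∧ ¬ (x = (T : X → X)^[m n] a ∧ T x = b)} ∪
        {x | x ∈ B n ∧ ¬ (T.symm x = (T : X → X)^[m n] a ∧ x = b)}
  -- The sum bounds the `ν`-mass of all columns over `A`; the Dirac masses keep `a` and `b` out of
  -- `A`, since `ν' A < 1`.
  let ν' : Measure X := (∑ i ∈ range (m n + 1), ν.map (T.symm : X → X)^[i]) +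
    (Measure.dirac a + Measure.dirac b)
  obtain ⟨A, hAB, hA, hAu, hlt⟩ := exists_uncountable_subset_measure_lt (hBm.measurable n)
    (hBm.uncountable n) ν' (ε := min (ε / 2) 1) (by simpa using hε)
  have hsum : ∑ i ∈ range (m n + 1), ν ((T : X → X)^[i] '' A) ≤ ν' A := by
    refine le_trans (le_of_eq ?_) (Measure.le_iff'.1 (Measure.le_add_right le_rfl) A)
    rw [Measure.finsetSum_apply]
    refine Finset.sum_congr rfl fun i _ => ?_
    rw [Measure.map_apply (T.symm.measurable.iterate i) hA, Set.image_eq_preimage_of_inverse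
      (Function.LeftInverse.iterate T.symm_apply_apply i)
      (Function.LeftInverse.iterate T.apply_symm_apply i)]
  have hdirac : ∀ c, Measure.dirac c ≤ ν' → c ∉ A := by
    intro c hc hcA
    have := (hc A).trans_lt (hlt.trans_le (min_le_right _ _))
    simp [Measure.dirac_apply_of_mem hcA] at this
  have haA : a ∉ A := hdirac a (Measure.le_add_left (Measure.le_add_right le_rfl))
  have hbA : b ∉ A := hdirac b (Measure.le_add_left (Measure.le_add_left le_rfl))
  obtain ⟨S, hS, hST, hSa⟩ := exists_odometer_of_tower T (hBm.measurable n) (hBm.disjoint n) hA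
    hAB hAu ⟨ha, haA⟩ ⟨hb, hbA⟩ hab
  refine ⟨S, hS, ?_⟩
  let W : Set X := ⋃ i ∈ range (m n + 1), (T : X → X)^[i] '' A
  have hW : ν W < ε / 2 :=
    ((measure_biUnion_finset_le _ _).trans hsum).trans_lt (hlt.trans_le (min_le_left _ _))
  have hsub : diffSet S T ⊆ W ∪ bad := by
    intro x hx
    by_contra hxW
    rw [Set.mem_union, not_or] at hxW
    obtain ⟨hxW, hxbad⟩ := hxW
    have hxs : x ∈ towerSupport T (B n) (m n) := by
      by_contra hxs
      exact hxbad (Or.inl (Or.inl hxs))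
    obtain ⟨i, hi, y, hy, rfl⟩ := hxs
    have hyA : y ∉ A := fun hyA =>
      hxW (Set.mem_biUnion (Finset.mem_coe.2 (Finset.mem_range.2 (by omega))) ⟨y, hyA, rfl⟩)
    rcases hx with hx | hx
    · apply hx
      rcases hi.eq_or_lt with rfl | hi
      · have : (T : X → X)^[m n] y = (T : X → X)^[m n] a ∧ T ((T : X → X)^[m n] y) = b := by
          by_contra hne
          exact hxbad (Or.inl (Or.inr ⟨⟨y, hy, rfl⟩, hne⟩))
        rw [this.2, this.1, hSa]
      · rw [hST y ⟨hy, hyA⟩ i hi, Function.iterate_succ_apply']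
    · apply hx
      -- Agreement of the inverses at a point is agreement of `S` and `T` one level below it.
      rw [eq_comm, MeasurableEquiv.symm_apply_eq, eq_comm]
      cases i with
      | zero =>
        have : T.symm y = (T : X → X)^[m n] a ∧ y = b := by
          by_contra hne
          exact hxbad (Or.inr ⟨hy, hne⟩)
        change S (T.symm y) = y
        rw [this.1, hSa, this.2]
      | succ i =>
        rw [Function.iterate_succ_apply', T.symm_apply_apply, hST y ⟨hy, hyA⟩ i (by omega),
          Function.iterate_succ_apply']
  calc ν (diffSet S T) ≤ ν W + ν bad := (measure_mono hsub).trans (measure_union_le _ _)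
    _ < ε / 2 + ε / 2 := ENNReal.add_lt_add hW hbad
    _ = ε := ENNReal.add_halves ε

end RankOne

/-! ### Neighborhoods in the uniform topology -/

section Neighborhoods

variable {X : Type*} [MeasurableSpace X]

lemma diffSet_subset_union (R S T : X ≃ᵐ X) : diffSet R T ⊆ diffSet R S ∪ diffSet S T := by
  intro x hx
  by_contra h
  simp only [diffSet, Set.mem_union, Set.mem_ofPred_eq, not_or, not_not] at h hx
  obtain ⟨⟨h1, h2⟩, h3, h4⟩ := h
  rcases hx with hx | hx
  · exact hx (h3.trans h1)
  · exact hx (h4.trans h2)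

/-- By the triangle inclusion for `diffSet`, a basic set contains a smaller one centred at each of
its points, and finitely many measures may be replaced by their sum. -/
lemma exists_measure_nhd_subset {U : Set (X ≃ᵐ X)} (hU : IsOpen[tau X] U) {T : X ≃ᵐ X}
    (hT : T ∈ U) : ∃ ν : Measure X, IsFiniteMeasure ν ∧ ∃ ε : ENNReal, ε ≠ 0 ∧
      ∀ S, ν (diffSet S T) < ε → S ∈ U := by
  induction hU with
  | basic V hV =>
    obtain ⟨T', n, μ, ε, hε, rfl⟩ := hV
    have hδ : ∃ δ : ℝ, 0 < δ ∧ ∀ i, ((μ i (diffSet T T') : NNReal) : ℝ) + δ < ε := by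
      have : ∀ᶠ δ in 𝓝[>] (0 : ℝ), ∀ i, ((μ i (diffSet T T') : NNReal) : ℝ) + δ < ε := by
        refine eventually_all.2 fun i => ?_
        have ht : Tendsto (fun δ : ℝ => ((μ i (diffSet T T') : NNReal) : ℝ) + δ) (𝓝[>] 0)
            (𝓝 (((μ i (diffSet T T') : NNReal) : ℝ) + 0)) :=
          ((continuous_const.add continuous_id).tendsto 0).mono_left nhdsWithin_le_nhds
        exact ht.eventually_lt_const (by simpa using hT i)
      obtain ⟨δ, h1, h2⟩ := (this.and self_mem_nhdsWithin).exists
      exact ⟨δ, h2, h1⟩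
    obtain ⟨δ, hδ, hlt⟩ := hδ
    refine ⟨∑ i, (μ i : Measure X), inferInstance, ENNReal.ofReal δ, by simpa using hδ,
      fun S hS i => ?_⟩
    have h1 : (μ i : Measure X) (diffSet S T) < ENNReal.ofReal δ := by
      refine lt_of_le_of_lt ?_ hS
      rw [Measure.finsetSum_apply]
      exact Finset.single_le_sum (f := fun i => (μ i : Measure X) (diffSet S T))
        (fun _ _ => zero_le) (Finset.mem_univ i)
    have h2 : ((μ i (diffSet S T) : NNReal) : ℝ) < δ := by
      rw [← ProbabilityMeasure.ennreal_coeFn_eq_coeFn_toMeasure, ENNReal.lt_ofReal_iff_toReal_lt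
        ENNReal.coe_ne_top] at h1
      exact h1
    have h3 : ((μ i (diffSet S T') : NNReal) : ℝ) ≤ μ i (diffSet S T) + μ i (diffSet T T') := by
      exact_mod_cast ((μ i).apply_mono (diffSet_subset_union S T T')).trans
        ((μ i).apply_union_le)
    linarith [hlt i]
  | univ => exact ⟨0, inferInstance, 1, one_ne_zero, fun _ _ => trivial⟩
  | inter V W _ _ ihV ihW =>
    obtain ⟨ν, hν, ε, hε, h⟩ := ihV hT.1
    obtain ⟨ν', hν', ε', hε', h'⟩ := ihW hT.2
    refine ⟨ν + ν', inferInstance, min ε ε', by simp [hε, hε'], fun S hS => ⟨h S ?_, h' S ?_⟩⟩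
    · exact (Measure.le_iff'.1 (Measure.le_add_right le_rfl) _).trans_lt
        (hS.trans_le (min_le_left _ _))
    · exact (Measure.le_iff'.1 (Measure.le_add_left le_rfl) _).trans_lt
        (hS.trans_le (min_le_right _ _))
  | sUnion 𝒱 _ ih =>
    obtain ⟨V, hV, hTV⟩ := hT
    obtain ⟨ν, hν, ε, hε, h⟩ := ih V hV hTV
    exact ⟨ν, hν, ε, hε, fun S hS => ⟨V, hV, h S hS⟩⟩

variable (X) in
lemma rankSet_one_subset_closure_odometers [StandardBorelSpace X] :
    rankSet X 1 ⊆ closure[tau X] (odometers X) := by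
  let := tau X
  intro T hT
  refine mem_closure_iff.2 fun U hU hTU => ?_
  obtain ⟨ν, hν, ε, hε, h⟩ := exists_measure_nhd_subset hU hTU
  obtain ⟨S, hS, hlt⟩ := hT.1.exists_odometer_measure_diffSet_lt ν hε
  exact ⟨S, h S hlt, hS⟩

end Neighborhoods

end BorelAut

theorem theorem2p8 {X : Type*} [MeasurableSpace X] [StandardBorelSpace X] :
    closure[BorelAut.tau X] (BorelAut.rankSet X 1) =
      closure[BorelAut.tau X] (BorelAut.odometers X) := by
  let := BorelAut.tau X
  exact subset_antisymm
    (closure_minimal (BorelAut.rankSet_one_subset_closure_odometers X) isClosed_closure)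
    (closure_mono (BorelAut.odometers_subset_rankSet_one X))
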